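/- \textbf{Definitions.} A \emph{compact ordered space} $(X,\mathscr T,\le)$ is a compact topological space with a (partial) order $\le$ that is closed in $X\times X$; a morphism is a continuous isotone map ($x\le y\Rightarrow g(x)\le g(y)$), and an isomorphism is a homeomorphism preserving and reflecting the order. Let $C(X,\mathbb C)$ be the $C^*$-algebra of continuous complex functions on $X$, and let $C^+(X,\le,\mathbb R)\subset C(X,\mathbb C)$ be the set of non-negative continuous isotone real functions. Consider pairs $(B,C)$, where $B$ is a commutative unital complex $C^*$-algebra and $C\subset B$ is a subset such that, with $H$ the set of hermitian elements of $B$, \begin{itemize} \item[(i)] $C+C\subset C$, and $aC\subset C$ for every real $a>0$; \item[(ii)] $C$ is closed; \item[(iii)] $\overline{C-C}=H$; \item[(iv)] one of the following holds: (1) $C$ consists of non-negative elements (hermitian with non-negative spectrum), and $\frac{2f^2}{1+f^2}\in C$ for every $f\in C$; or (2) for every $f\in C$ the element $1+f$ is invertible and $\left(\frac{2f}{1+f}\right)^2\in C$. \end{itemize} A morphism $(B,C)\to(B',C')$ is a unital $*$-homomorphism $\varphi:B\to B'$ with $\varphi(C)\subset C'$; an isomorphism is a $*$-isomorphism $\varphi$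 with $\varphi(C)=C'$. (The zero algebra and the empty space are allowed; they correspond to each other.) \textbf{Theorem.} There is a one-to-one correspondence (a duality), up to canonical isomorphism, between compact ordered spaces and pairs $(B,C)$ as above, implemented by the following two maps. \emph{Map I:} to $(B,C)$ associate $X(B,C)$, the set of characters of $B$ with the weak-$*$ topology and the relation $x\le y\iff x(f)\le y(f)$ for all $f\in C$. \emph{Map II:} to $(X,\mathscr T,\le)$ associate the pair $(C(X,\mathbb C),C^+(X,\le,\mathbb R))$. Precisely: \begin{enumerate} \item For every pair $(B,C)$ as above, $X(B,C)$ is a compact ordered space. \item For every compact ordered space $X$, the pair $(C(X,\mathbb C),C^+(X,\le,\mathbb R))$ satisfies (i)--(iv). \item For every pair $(B,C)$ as above, the Gelfand map $f\mapsto\hat f$, $\hat f(x)=x(f)$, is an isometric $*$-isomorphism of $B$ onto $C(X(B,C),\mathbb C)$ that maps $C$ onto $C^+(X(B,C),\le,\mathbb R)$. \item For every compact ordered space $X$, the evaluation map $p\mapsto(f\mapsto f(p))$ is a homeomorphism of $X$ onto $X\big(C(X,\mathbb C),C^+(X,\le,\mathbb R)\big)$ that preserves and reflects the order. \item Two pairs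 are isomorphic if and only if the associated spaces are isomorphic, and two compact ordered spaces are isomorphic if and only if the associated pairs are isomorphic. \item The correspondence is contravariant and bijective on morphisms: for pairs $(B,C)$, $(B',C')$ as above, $\varphi\mapsto(x\mapsto x\circ\varphi)$ is a bijection from morphisms $(B,C)\to(B',C')$ to morphisms $X(B',C')\to X(B,C)$; and for compact ordered spaces $X,Y$, $g\mapsto(f\mapsto f\circ g)$ is a bijection from morphisms $X\to Y$ to morphisms $(C(Y,\mathbb C),C^+(Y,\le,\mathbb R))\to(C(X,\mathbb C),C^+(X,\le,\mathbb R))$. \end{enumerate} -/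

import Mathlib

universe u

section ConePairs

variable {B : Type u} [CommCStarAlgebra B]

open ComplexOrder in
/-- The conditions (i)-(iv) on a subset `C` of a commutative unital complex C*-algebra `B`.
`Ring.inverse` is the inverse on invertible elements. In `stable`, first alternative, `1 + f ^ 2`
is automatically invertible because `f` is non-negative; in the second alternative, that
`(2 f / (1 + f)) ^ 2` is well defined is the clause `IsUnit (1 + f)`. -/
structure IsIsotoneCone (C : Set B) : Prop where
  add_mem : ∀ f ∈ C, ∀ g ∈ C, f + g ∈ C
  smul_mem : ∀ a : ℝ, 0 < a → ∀ f ∈ C, (a : ℂ) • f ∈ C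
  isClosed : IsClosed C
  closure_sub : closure {h : B | ∃ f ∈ C, ∃ g ∈ C, h = f - g} = {h : B | IsSelfAdjoint h}
  stable :
    (∀ f ∈ C, (IsSelfAdjoint f ∧ ∀ z ∈ spectrum ℂ f, 0 ≤ z) ∧
      2 * f ^ 2 * Ring.inverse (1 + f ^ 2) ∈ C) ∨
    (∀ f ∈ C, IsUnit (1 + f) ∧ (2 * f * Ring.inverse (1 + f)) ^ 2 ∈ C)

/-- The Gelfand spectrum (set of characters) of `B`, with the weak-* topology, to be preordered
by means of the subset `C` of `B`. -/
def OrderedSpectrum (_C : Set B) : Type u := WeakDual.characterSpace ℂ B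

namespace OrderedSpectrum

variable (C : Set B)

instance : TopologicalSpace (OrderedSpectrum C) :=
  inferInstanceAs (TopologicalSpace (WeakDual.characterSpace ℂ B))

instance : CompactSpace (OrderedSpectrum C) :=
  inferInstanceAs (CompactSpace (WeakDual.characterSpace ℂ B))

noncomputable instance : FunLike (OrderedSpectrum C) B ℂ :=
  inferInstanceAs (FunLike (WeakDual.characterSpace ℂ B) B ℂ)

open ComplexOrder in
/-- `x ≤ y` if and only if `x f ≤ y f` for all `f ∈ C`. -/
noncomputable instance : Preorder (OrderedSpectrum C) where
  le x y := ∀ f ∈ C, x f ≤ y f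
  le_refl _ _ _ := le_rfl
  le_trans _ _ _ h₁ h₂ f hf := (h₁ f hf).trans (h₂ f hf)

end OrderedSpectrum

end ConePairs

/-- The set of non-negative continuous isotone real functions on `X`, regarded as a subset of
the algebra of continuous complex functions on `X`. -/
def nonnegIsotone (X : Type u) [TopologicalSpace X] [Preorder X] : Set C(X, ℂ) :=
  {f | ∃ g : C(X, ℝ), (∀ x, 0 ≤ g x) ∧ Monotone g ∧ ∀ x, f x = (g x : ℂ)}

/-- A compact ordered space: a compact topological space with an antisymmetric preorder which
is closed in the product topology. -/
structure IsCompactOrderedSpace (X : Type u) [TopologicalSpace X] [Preorder X] : Prop where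
  compact : CompactSpace X
  closed : IsClosed {p : X × X | p.1 ≤ p.2}
  antisymm : ∀ x y : X, x ≤ y → y ≤ x → x = y

/-- Isomorphism of pairs `(B, C)`: a *-isomorphism of the algebras carrying the one subset onto
the other. -/
def PairIso {B B' : Type u} [CommCStarAlgebra B] [CommCStarAlgebra B']
    (C : Set B) (C' : Set B') : Prop :=
  ∃ e : B ≃⋆ₐ[ℂ] B', e '' C = C'

/-- Isomorphism of topological preordered spaces: a homeomorphism which preserves and reflects
the preorder. -/
def SpaceIso (X Y : Type u) [TopologicalSpace X] [Preorder X] [TopologicalSpace Y] [Preorder Y] :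
    Prop :=
  ∃ e : X ≃ₜ Y, ∀ x y, e x ≤ e y ↔ x ≤ y

/-! Gelfand duality already identifies `B` with the continuous functions on its characters, so only
the cone and the order are at stake. Two facts are needed: a compact ordered space has enough
isotone functions, and a cone satisfying the axioms contains every non-negative continuous function
that is isotone for the order it defines.

The first is an ordered Urysohn lemma (`IsCompactOrderedSpace.exists_monotone`); combined with
Stone–Weierstrass it also gives the density in (iii).

The second (`IsStableCone.mem_of_isotone`) rests on (iv): either alternative makes the cone stable
under a map of [0, ∞) whose iterates push values below 1 to 0 and values above 1 down to 1. If x ≤ y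
fails, some f in the cone has f y < f x; rescaled so that 1 lies between these values and then
iterated, it becomes nearly an indicator. Sums, averages and compactness extend this from points to
compact sets. Finally an isotone g is a uniform limit of sums of thin layers, each nearly the
indicator of a superlevel set of g. -/

open Set Filter Topology

/-! ### Threshold maps and their iterates -/

/-- A monotone continuous self-map of `[0, ∞)` which fixes `0` and `1` and strictly decreases all
other points. Its iterates converge to the indicator function of `[1, ∞)`. -/
structure IsThreshold (h : ℝ → ℝ) : Prop where
  continuousOn : ContinuousOn h (Ici 0)
  monotoneOn : MonotoneOn h (Ici 0)
  map_zero : h 0 = 0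
  map_one : h 1 = 1
  lt_self : ∀ t, 0 < t → t ≠ 1 → h t < t

namespace IsThreshold

variable {h : ℝ → ℝ}

theorem nonneg (hh : IsThreshold h) {t : ℝ} (ht : 0 ≤ t) : 0 ≤ h t := by
  have := hh.monotoneOn (mem_Ici.2 le_rfl) (mem_Ici.2 ht) ht
  rwa [hh.map_zero] at this

theorem le_self (hh : IsThreshold h) {t : ℝ} (ht : 0 ≤ t) : h t ≤ t := by
  rcases ht.eq_or_lt with rfl | h0
  · exact hh.map_zero.le
  · by_cases h1 : t = 1
    · rw [h1, hh.map_one]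
    · exact (hh.lt_self t h0 h1).le

theorem iterate_nonneg (hh : IsThreshold h) {t : ℝ} (ht : 0 ≤ t) (n : ℕ) : 0 ≤ h^[n] t := by
  induction n with
  | zero => simpa
  | succ n ih => rw [Function.iterate_succ_apply']; exact hh.nonneg ih

theorem iterate_mono (hh : IsThreshold h) {s t : ℝ} (hs : 0 ≤ s) (hst : s ≤ t) (n : ℕ) :
    h^[n] s ≤ h^[n] t := by
  induction n with
  | zero => simpa
  | succ n ih =>
    rw [Function.iterate_succ_apply', Function.iterate_succ_apply']
    exact hh.monotoneOn (hh.iterate_nonneg hs n) (hh.iterate_nonneg (hs.trans hst) n) ih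

theorem one_le_iterate (hh : IsThreshold h) {t : ℝ} (ht : 1 ≤ t) (n : ℕ) : 1 ≤ h^[n] t := by
  have := hh.iterate_mono zero_le_one ht n
  rwa [Function.iterate_fixed hh.map_one] at this

theorem antitone_iterate (hh : IsThreshold h) {t : ℝ} (ht : 0 ≤ t) :
    Antitone fun n => h^[n] t :=
  antitone_nat_of_succ_le fun n => by
    rw [Function.iterate_succ_apply']; exact hh.le_self (hh.iterate_nonneg ht n)

/-- The orbit decreases and is bounded below, and by continuity its limit is a fixed point, hence 0
or 1. The bound `l ≤ t` excludes 1 when `t < 1`. -/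
theorem exists_tendsto_iterate (hh : IsThreshold h) {t : ℝ} (ht : 0 ≤ t) :
    ∃ l, Tendsto (fun n => h^[n] t) atTop (𝓝 l) ∧ (l = 0 ∨ l = 1) ∧ l ≤ t := by
  have hb : BddBelow (range fun n => h^[n] t) :=
    ⟨0, by rintro _ ⟨n, rfl⟩; exact hh.iterate_nonneg ht n⟩
  have hl := tendsto_atTop_ciInf (hh.antitone_iterate ht) hb
  set l := ⨅ n, h^[n] t
  have hl0 : 0 ≤ l := ge_of_tendsto' hl (hh.iterate_nonneg ht)
  have hlt : l ≤ t := by simpa using ciInf_le hb 0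
  refine ⟨l, hl, ?_, hlt⟩
  have h1 : Tendsto (fun n => h (h^[n] t)) atTop (𝓝 (h l)) :=
    (hh.continuousOn l hl0).tendsto.comp
      (tendsto_nhdsWithin_iff.2 ⟨hl, Eventually.of_forall (hh.iterate_nonneg ht)⟩)
  have h2 : Tendsto (fun n => h (h^[n] t)) atTop (𝓝 l) := by
    simpa only [Function.iterate_succ_apply'] using (tendsto_add_atTop_iff_nat 1).2 hl
  have hfix := tendsto_nhds_unique h1 h2
  by_contra! hne
  exact (hh.lt_self l (lt_of_le_of_ne hl0 hne.1.symm) hne.2).ne hfix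

/-- The iterates converge to the indicator function of `[1, ∞)` uniformly on bounded sets away
from the jump. -/
theorem exists_iterate (hh : IsThreshold h) (M : ℝ) {c ε : ℝ} (hc : c < 1) (hε : 0 < ε) :
    ∃ n, ∀ t, 0 ≤ t → (t ≤ M → h^[n] t ≤ 1 + ε) ∧ (1 ≤ t → 1 ≤ h^[n] t) ∧
      (t ≤ c → h^[n] t ≤ ε) := by
  -- Iterates are monotone, so controlling the two orbits that start at the upper ends `M` and `c`
  -- controls all others uniformly. The maxima with 0 keep the starting points in the domain.
  obtain ⟨l, hl, hl01, -⟩ := hh.exists_tendsto_iterate (le_max_right M 0)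
  obtain ⟨l', hl', hl01', hlc⟩ := hh.exists_tendsto_iterate (le_max_right c 0)
  have hl1 : l < 1 + ε := by rcases hl01 with rfl | rfl <;> linarith
  have hl0 : l' < ε := by
    rcases hl01' with rfl | rfl
    · exact hε
    · exact absurd hlc (not_le.2 (max_lt hc one_pos))
  obtain ⟨n, hn1, hn2⟩ := ((hl.eventually_lt_const hl1).and (hl'.eventually_lt_const hl0)).exists
  refine ⟨n, fun t ht => ⟨fun h1 => ?_, fun h1 => hh.one_le_iterate h1 n, fun h1 => ?_⟩⟩
  · exact (hh.iterate_mono ht (h1.trans (le_max_left _ _)) n).trans hn1.le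
  · exact (hh.iterate_mono ht (h1.trans (le_max_left _ _)) n).trans hn2.le

end IsThreshold

/-- The strict decrease is t - h t = t (t - 1)² / (1 + t²). -/
theorem isThreshold_sq_div : IsThreshold fun t => 2 * t ^ 2 / (1 + t ^ 2) where
  continuousOn := (Continuous.div (by fun_prop) (by fun_prop) fun t => by positivity).continuousOn
  monotoneOn s hs t ht hst := by
    simp only [mem_Ici] at hs ht
    have : s ^ 2 ≤ t ^ 2 := by gcongr
    show 2 * s ^ 2 / (1 + s ^ 2) ≤ 2 * t ^ 2 / (1 + t ^ 2)
    rw [div_le_div_iff₀ (by positivity) (by positivity)]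
    nlinarith
  map_zero := by norm_num
  map_one := by norm_num
  lt_self t ht ht1 := by
    rw [div_lt_iff₀ (by positivity)]
    have : 0 < (t - 1) ^ 2 := by have := sub_ne_zero.2 ht1; positivity
    nlinarith [mul_pos ht this]

/-- The strict decrease is t - h t = t (t - 1)² / (1 + t)². -/
theorem isThreshold_div_sq : IsThreshold fun t => (2 * t / (1 + t)) ^ 2 where
  continuousOn := by
    refine (ContinuousOn.div (by fun_prop) (by fun_prop) fun t ht => ?_).pow 2
    have : 0 ≤ t := ht
    positivity
  monotoneOn s hs t ht hst := by
    simp only [mem_Ici] at hs ht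
    have : 2 * s / (1 + s) ≤ 2 * t / (1 + t) := by
      rw [div_le_div_iff₀ (by positivity) (by positivity)]
      nlinarith
    show (2 * s / (1 + s)) ^ 2 ≤ (2 * t / (1 + t)) ^ 2
    gcongr
  map_zero := by norm_num
  map_one := by norm_num
  lt_self t ht ht1 := by
    rw [div_pow, div_lt_iff₀ (by positivity)]
    have : 0 < (t - 1) ^ 2 := by have := sub_ne_zero.2 ht1; positivity
    nlinarith [mul_pos ht this]

/-! ### Separation and approximation inside a stable cone -/

/-- A closed convex cone of non-negative continuous functions, without common zero, which is
stable under composition with `h`. -/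
structure IsStableCone {X : Type*} [TopologicalSpace X] (h : ℝ → ℝ) (S : Set C(X, ℝ)) : Prop where
  zero_mem : 0 ∈ S
  add_mem : ∀ f ∈ S, ∀ g ∈ S, f + g ∈ S
  smul_mem : ∀ a : ℝ, 0 < a → ∀ f ∈ S, a • f ∈ S
  isClosed : IsClosed S
  nonneg : ∀ f ∈ S, ∀ x, 0 ≤ f x
  exists_pos : ∀ x, ∃ f ∈ S, 0 < f x
  stable : ∀ f ∈ S, ∃ g ∈ S, ∀ x, g x = h (f x)

/-- The function equal to one on `A` and to zero on `B` is approximable from `S` on `A ∪ B`, with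
upper bounds close to one everywhere. -/
def ApproxSeparates {X : Type*} [TopologicalSpace X] (S : Set C(X, ℝ)) (A B : Set X) : Prop :=
  ∀ ε > 0, ∃ F ∈ S, (∀ x, F x ≤ 1 + ε) ∧ (∀ x ∈ A, 1 ≤ F x) ∧ ∀ x ∈ B, F x ≤ ε

theorem ApproxSeparates.mono {X : Type*} [TopologicalSpace X] {S : Set C(X, ℝ)} {A A' B B' : Set X}
    (H : ApproxSeparates S A B) (hA : A' ⊆ A) (hB : B' ⊆ B) : ApproxSeparates S A' B' := by
  intro ε hε
  obtain ⟨F, hF, h1, h2, h3⟩ := H ε hε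
  exact ⟨F, hF, h1, fun x hx => h2 x (hA hx), fun x hx => h3 x (hB hx)⟩

namespace IsStableCone

variable {X : Type*} [TopologicalSpace X] {h : ℝ → ℝ} {S : Set C(X, ℝ)}

theorem iterate_mem (hS : IsStableCone h S) (n : ℕ) {f : C(X, ℝ)} (hf : f ∈ S) :
    ∃ g ∈ S, ∀ x, g x = h^[n] (f x) := by
  induction n with
  | zero => exact ⟨f, hf, fun x => rfl⟩
  | succ n ih =>
    obtain ⟨g, hg, hgx⟩ := ih
    obtain ⟨k, hk, hkx⟩ := hS.stable g hg
    exact ⟨k, hk, fun x => by rw [hkx, hgx, Function.iterate_succ_apply']⟩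

variable [CompactSpace X]

/-- Iterating `h` amplifies any gap below 1, so one crude separating function yields arbitrarily
sharp ones. -/
theorem approxSeparates_of_lt (hS : IsStableCone h S) (hh : IsThreshold h) {A B : Set X}
    {F : C(X, ℝ)} (hF : F ∈ S) {c : ℝ} (hc : c < 1) (hA : ∀ x ∈ A, 1 ≤ F x)
    (hB : ∀ x ∈ B, F x ≤ c) : ApproxSeparates S A B := by
  intro ε hε
  obtain ⟨n, hn⟩ := hh.exists_iterate ‖F‖ hc hε
  obtain ⟨G, hG, hGx⟩ := hS.iterate_mem n hF
  refine ⟨G, hG, fun x => ?_, fun x hx => ?_, fun x hx => ?_⟩ <;> rw [hGx]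
  · exact (hn _ (hS.nonneg F hF x)).1 ((le_abs_self _).trans (F.norm_coe_le_norm x))
  · exact (hn _ (hS.nonneg F hF x)).2.1 (hA x hx)
  · exact (hn _ (hS.nonneg F hF x)).2.2 (hB x hx)

theorem approxSeparates_union_left (hS : IsStableCone h S) (hh : IsThreshold h) {A A' B : Set X}
    (H : ApproxSeparates S A B) (H' : ApproxSeparates S A' B) : ApproxSeparates S (A ∪ A') B := by
  obtain ⟨F, hF, -, h2, h3⟩ := H (1 / 4) (by norm_num)
  obtain ⟨F', hF', -, h2', h3'⟩ := H' (1 / 4) (by norm_num)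
  -- The sum stays at least 1 on both sets by non-negativity, and is at most 1/4 + 1/4 on `B`.
  refine hS.approxSeparates_of_lt hh (hS.add_mem F hF F' hF') (c := 1 / 2) (by norm_num) ?_ ?_
  · rintro x (hx | hx) <;> rw [ContinuousMap.add_apply]
    · linarith [h2 x hx, hS.nonneg F' hF' x]
    · linarith [h2' x hx, hS.nonneg F hF x]
  · intro x hx
    rw [ContinuousMap.add_apply]
    linarith [h3 x hx, h3' x hx]

theorem approxSeparates_union_right (hS : IsStableCone h S) (hh : IsThreshold h) {A B B' : Set X}
    (H : ApproxSeparates S A B) (H' : ApproxSeparates S A B') : ApproxSeparates S A (B ∪ B') := by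
  obtain ⟨F, hF, h1, h2, h3⟩ := H (1 / 4) (by norm_num)
  obtain ⟨F', hF', h1', h2', h3'⟩ := H' (1 / 4) (by norm_num)
  -- The average plays the role of an intersection. The global bound 1 + ε matters here: on either
  -- right-hand set the average is at most (1/4 + 5/4) / 2 = 3/4.
  refine hS.approxSeparates_of_lt hh
    (hS.smul_mem (1 / 2) (by norm_num) _ (hS.add_mem F hF F' hF')) (c := 3 / 4) (by norm_num) ?_ ?_
  · intro x hx
    rw [ContinuousMap.smul_apply, ContinuousMap.add_apply, smul_eq_mul]
    linarith [h2 x hx, h2' x hx]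
  · rintro x (hx | hx) <;> rw [ContinuousMap.smul_apply, ContinuousMap.add_apply, smul_eq_mul]
    · linarith [h3 x hx, h1' x]
    · linarith [h3' x hx, h1 x]

theorem approxSeparates_nhds (hS : IsStableCone h S) (hh : IsThreshold h) {B : Set X}
    (hB : IsCompact B) {x : X} (H : ∀ y ∈ B, ∃ f ∈ S, f y < f x) :
    ∃ U ∈ 𝓝 x, ApproxSeparates S U B := by
  refine hB.induction_on (p := fun B => ∃ U ∈ 𝓝 x, ApproxSeparates S U B) ?_ ?_ ?_ ?_
  -- Even for empty `B` a cone element at least 1 near `x` is required, hence the need for no common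
  -- zero.
  · obtain ⟨f, hf, hfx⟩ := hS.exists_pos x
    refine ⟨{z | 1 < ((2 / f x) • f) z}, ?_, ?_⟩
    · refine (isOpen_lt continuous_const (map_continuous _)).mem_nhds ?_
      rw [mem_ofPred_eq, ContinuousMap.smul_apply, smul_eq_mul, div_mul_cancel₀ _ hfx.ne']
      norm_num
    · exact hS.approxSeparates_of_lt hh (hS.smul_mem _ (by positivity) f hf) zero_lt_one
        (fun z hz => le_of_lt hz) (by simp)
  · rintro s t hst ⟨U, hU, hUt⟩
    exact ⟨U, hU, hUt.mono le_rfl hst⟩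
  · rintro s t ⟨U, hU, hUs⟩ ⟨V, hV, hVt⟩
    exact ⟨U ∩ V, inter_mem hU hV, hS.approxSeparates_union_right hh
      (hUs.mono inter_subset_left le_rfl) (hVt.mono inter_subset_right le_rfl)⟩
  · intro y hy
    obtain ⟨f, hf, hlt⟩ := H y hy
    have hy0 := hS.nonneg f hf y
    have hsum : 0 < f x + f y := by linarith
    -- This scaling sends the midpoint of `f y` and `f x` to the threshold 1.
    set F := (2 / (f x + f y)) • f with hFdef
    have hF : F ∈ S := hS.smul_mem _ (by positivity) f hf
    have hFx : 1 < F x := by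
      rw [hFdef, ContinuousMap.smul_apply, smul_eq_mul, div_mul_eq_mul_div, lt_div_iff₀ hsum]
      linarith
    have hFy : F y < 1 := by
      rw [hFdef, ContinuousMap.smul_apply, smul_eq_mul, div_mul_eq_mul_div, div_lt_iff₀ hsum]
      linarith
    obtain ⟨c, hc, hc1⟩ := exists_between hFy
    refine ⟨{z | F z < c}, mem_nhdsWithin_of_mem_nhds
      ((isOpen_lt (map_continuous F) continuous_const).mem_nhds hc), {z | 1 < F z},
      (isOpen_lt continuous_const (map_continuous F)).mem_nhds hFx, ?_⟩
    exact hS.approxSeparates_of_lt hh hF hc1 (fun z hz => le_of_lt hz) fun z hz => le_of_lt hz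

theorem approxSeparates (hS : IsStableCone h S) (hh : IsThreshold h) {A B : Set X}
    (hA : IsCompact A) (hB : IsCompact B) (H : ∀ x ∈ A, ∀ y ∈ B, ∃ f ∈ S, f y < f x) :
    ApproxSeparates S A B := by
  refine hA.induction_on (p := fun A => ApproxSeparates S A B) ?_ ?_ ?_ ?_
  · exact hS.approxSeparates_of_lt hh hS.zero_mem zero_lt_one (by simp) (by simp)
  · exact fun s t hst ht => ht.mono hst le_rfl
  · exact fun s t => hS.approxSeparates_union_left hh
  · intro x hx
    obtain ⟨U, hU, hUB⟩ := hS.approxSeparates_nhds hh hB (H x hx)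
    exact ⟨U, mem_nhdsWithin_of_mem_nhds hU, hUB⟩

/-- Layer-cake construction of an approximation to min(g, kε): each layer adds ε times a
near-indicator. The upper error is one ε for the layer in transition plus εδ for each layer. The
last bound holds without regard to `g`, and controls the lower layers at points where the new one
may be in transition. -/
theorem exists_approx_truncation (hS : IsStableCone h S) (hh : IsThreshold h) {g : C(X, ℝ)}
    (hmono : ∀ x y, (∀ f ∈ S, f x ≤ f y) → g x ≤ g y) {ε δ : ℝ} (hε : 0 < ε)
    (hδ : 0 < δ) (k : ℕ) :
    ∃ G ∈ S, ∀ x, (k * ε ≤ g x → k * ε ≤ G x) ∧ (g x ≤ k * ε → g x - ε ≤ G x) ∧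
      (0 ≤ g x → G x ≤ g x + ε + k * (ε * δ)) ∧ G x ≤ k * ε + k * (ε * δ) := by
  induction k with
  | zero =>
    refine ⟨0, hS.zero_mem, fun x => ⟨by simp, fun hx => ?_, fun hx => ?_, by simp⟩⟩
    · simp only [Nat.cast_zero, zero_mul] at hx
      rw [ContinuousMap.zero_apply]; linarith
    · simp only [ContinuousMap.zero_apply, Nat.cast_zero, zero_mul]; linarith
  | succ k ih =>
    obtain ⟨G, hG, hGx⟩ := ih
    have hsep : ApproxSeparates S {x | (k + 1) * ε ≤ g x} {x | g x ≤ k * ε} := by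
      refine hS.approxSeparates hh
        (isClosed_le continuous_const (map_continuous g)).isCompact
        (isClosed_le (map_continuous g) continuous_const).isCompact fun x hx y hy => ?_
      -- Otherwise `x` lies below `y`, and isotony of `g` contradicts the gap between the two
      -- levels.
      by_contra! hcon
      have := hmono x y hcon
      simp only [mem_ofPred_eq] at hx hy
      linarith
    obtain ⟨F, hF, h1, h2, h3⟩ := hsep δ hδ
    refine ⟨G + ε • F, hS.add_mem G hG _ (hS.smul_mem ε hε F hF), fun x => ?_⟩
    obtain ⟨g1, g2, g3, g4⟩ := hGx x
    have hF0 : 0 ≤ ε * F x := mul_nonneg hε.le (hS.nonneg F hF x)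
    have hF1 : ε * F x ≤ ε * (1 + δ) := mul_le_mul_of_nonneg_left (h1 x) hε.le
    have hF2 : (k + 1) * ε ≤ g x → ε * 1 ≤ ε * F x :=
      fun hx => mul_le_mul_of_nonneg_left (h2 x hx) hε.le
    have hF3 : g x ≤ k * ε → ε * F x ≤ ε * δ := fun hx => mul_le_mul_of_nonneg_left (h3 x hx) hε.le
    rw [ContinuousMap.add_apply, ContinuousMap.smul_apply, smul_eq_mul, Nat.cast_succ]
    refine ⟨fun hx => ?_, fun hx => ?_, fun hx => ?_, ?_⟩
    · have := g1 (by linarith)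
      linarith [hF2 hx]
    · rcases le_total (g x) (k * ε) with hk | hk
      · linarith [g2 hk]
      · linarith [g1 hk]
    · rcases le_total (g x) (k * ε) with hk | hk
      · linarith [g3 hx, hF3 hk]
      · linarith
    · linarith

/-- A stable cone contains every non-negative continuous function which is isotone with respect
to the preorder defined by the cone. -/
theorem mem_of_isotone (hS : IsStableCone h S) (hh : IsThreshold h) {g : C(X, ℝ)}
    (hg : ∀ x, 0 ≤ g x) (hmono : ∀ x y, (∀ f ∈ S, f x ≤ f y) → g x ≤ g y) : g ∈ S := by
  rw [← hS.isClosed.closure_eq, Metric.mem_closure_iff]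
  intro ε hε
  -- With layers of height ε/4, `k` of them exceed `‖g‖`, so nothing is truncated; δ = 1/k keeps the
  -- accumulated error at ε/4, for a total of at most ε/2.
  obtain ⟨k, hk⟩ := exists_nat_gt (‖g‖ / (ε / 4))
  have hk' : ‖g‖ < k * (ε / 4) := (div_lt_iff₀ (by positivity)).1 hk
  have hk0 : (0 : ℝ) < k := lt_of_le_of_lt (by positivity) hk
  obtain ⟨G, hG, hGx⟩ := hS.exists_approx_truncation hh hmono (ε := ε / 4) (δ := 1 / k)
    (by positivity) (by positivity) k
  refine ⟨G, hG, lt_of_le_of_lt ((ContinuousMap.dist_le (C := ε / 2) (by positivity)).2 fun x => ?_)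
    (by linarith)⟩
  obtain ⟨-, g2, g3, -⟩ := hGx x
  have hle : g x ≤ k * (ε / 4) := ((le_abs_self _).trans (g.norm_coe_le_norm x)).trans hk'.le
  have e1 : (k : ℝ) * (ε / 4 * (1 / k)) = ε / 4 := by field_simp
  rw [e1] at g3
  rw [Real.dist_eq, abs_le]
  constructor <;> linarith [g2 hle, g3 (hg x)]

end IsStableCone

/-! ### Ordered Urysohn lemma for compact ordered spaces -/

/-- Stage zero is the indicator of the complement of a lower set; each later stage averages two
earlier ones. -/
theorem Urysohns.CU.monotone_approx {X : Type*} [TopologicalSpace X] [Preorder X]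
    {P : Set X → Set X → Prop} (hP : ∀ C U, P C U → IsLowerSet U) (n : ℕ) (c : Urysohns.CU P) :
    Monotone (c.approx n) := by
  induction n generalizing c with
  | zero =>
    intro x y hxy
    by_cases hx : x ∈ c.U
    · rw [Urysohns.CU.approx, indicator_of_notMem (by simpa using hx)]
      exact indicator_nonneg (fun _ _ => zero_le_one) _
    · have hy : y ∉ c.U := fun hy => hx (hP _ _ c.P_C_U hxy hy)
      rw [c.approx_of_notMem_U 0 hx, c.approx_of_notMem_U 0 hy]
  | succ n ih => exact fun x y hxy => midpoint_le_midpoint (ih _ hxy) (ih _ hxy)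

theorem Urysohns.CU.monotone_lim {X : Type*} [TopologicalSpace X] [Preorder X]
    {P : Set X → Set X → Prop} (hP : ∀ C U, P C U → IsLowerSet U) (c : Urysohns.CU P) :
    Monotone c.lim := fun x y hxy =>
  le_of_tendsto_of_tendsto' (c.tendsto_approx_atTop x) (c.tendsto_approx_atTop y)
    fun n => c.monotone_approx hP n hxy

namespace IsCompactOrderedSpace

variable {X : Type u} [TopologicalSpace X] [Preorder X]

theorem t2Space (hX : IsCompactOrderedSpace X) : T2Space X := by
  rw [t2_iff_isClosed_diagonal]
  have : diagonal X = {p : X × X | p.1 ≤ p.2} ∩ Prod.swap ⁻¹' {p : X × X | p.1 ≤ p.2} := by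
    ext ⟨x, y⟩
    exact ⟨fun h => by obtain rfl : x = y := h; exact ⟨le_rfl, le_rfl⟩,
      fun h => hX.antisymm x y h.1 h.2⟩
  rw [this]
  exact hX.closed.inter (hX.closed.preimage continuous_swap)

/-- It is the projection of a compact piece of the graph of the order. -/
theorem isClosed_lowerClosure (hX : IsCompactOrderedSpace X) {s : Set X} (hs : IsClosed s) :
    IsClosed (lowerClosure s : Set X) := by
  have := hX.compact
  have := hX.t2Space
  have : (lowerClosure s : Set X) = Prod.fst '' ({p : X × X | p.1 ≤ p.2} ∩ Prod.snd ⁻¹' s) := by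
    ext x
    simp [mem_lowerClosure, and_comm]
  rw [this]
  exact ((hX.closed.inter (hs.preimage continuous_snd)).isCompact.image continuous_fst).isClosed

theorem isClosed_upperClosure (hX : IsCompactOrderedSpace X) {s : Set X} (hs : IsClosed s) :
    IsClosed (upperClosure s : Set X) := by
  have := hX.compact
  have := hX.t2Space
  have : (upperClosure s : Set X) = Prod.snd '' ({p : X × X | p.1 ≤ p.2} ∩ Prod.fst ⁻¹' s) := by
    ext x
    simp [mem_upperClosure, and_comm]
  rw [this]
  exact ((hX.closed.inter (hs.preimage continuous_fst)).isCompact.image continuous_snd).isClosed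

/-- A compact ordered space is normally ordered. -/
theorem exists_isLowerSet_between (hX : IsCompactOrderedSpace X) {c u : Set X} (hc : IsClosed c)
    (hu : IsOpen u) (hul : IsLowerSet u) (hcu : c ⊆ u) :
    ∃ v, IsOpen v ∧ c ⊆ v ∧ closure v ⊆ u ∧ IsLowerSet v := by
  have := hX.compact
  have := hX.t2Space
  obtain ⟨w, hw, hcw, hwu⟩ := normal_exists_closure_subset (hX.isClosed_lowerClosure hc) hu
    (lowerClosure_min hcu hul)
  -- Normality gives `w`, which need not be a lower set; this is the largest lower set inside it,
  -- and it still contains the lower closure of `c`.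
  refine ⟨(upperClosure wᶜ : Set X)ᶜ, (hX.isClosed_upperClosure hw.isClosed_compl).isOpen_compl,
    fun x hx hxw => ?_, ?_, (upperClosure wᶜ).upper.compl⟩
  · obtain ⟨y, hy, hyx⟩ := hxw
    exact hy (hcw ⟨x, hx, hyx⟩)
  · exact (closure_mono (compl_subset_comm.1 subset_upperClosure)).trans hwu

/-- Points of a compact ordered space are separated by isotone functions. -/
theorem exists_monotone (hX : IsCompactOrderedSpace X) {x y : X} (hxy : ¬ x ≤ y) :
    ∃ g : C(X, ℝ), (∀ z, 0 ≤ g z) ∧ Monotone g ∧ g y < g x := by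
  have := hX.compact
  have := hX.t2Space
  -- Urysohn's construction run through open lower sets only, so that the limit function is isotone;
  -- it is 0 at `y` and 1 at `x`.
  let c : Urysohns.CU fun _ U : Set X => IsLowerSet U :=
    { C := lowerClosure {y}
      U := (upperClosure {x} : Set X)ᶜ
      P_C_U := (upperClosure {x}).upper.compl
      closed_C := hX.isClosed_lowerClosure isClosed_singleton
      open_U := (hX.isClosed_upperClosure isClosed_singleton).isOpen_compl
      subset := by
        intro z hzy hxz
        simp only [lowerClosure_singleton, LowerSet.coe_Iic, mem_Iic, upperClosure_singleton,
          UpperSet.coe_Ici, mem_Ici] at hzy hxz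
        exact hxy (hxz.trans hzy)
      hP := fun {c u} hc hu hou hcu => by
        obtain ⟨v, h1, h2, h3, h4⟩ := hX.exists_isLowerSet_between hc hou hu hcu
        exact ⟨v, h1, h2, h3, h4, hu⟩ }
  refine ⟨⟨c.lim, c.continuous_lim⟩, c.lim_nonneg, c.monotone_lim (fun _ _ h => h), ?_⟩
  show c.lim y < c.lim x
  rw [c.lim_of_mem_C y (subset_lowerClosure rfl),
    c.lim_of_notMem_U x fun h => h (subset_upperClosure rfl)]
  exact zero_lt_one

end IsCompactOrderedSpace

/-! ### The isotone functions satisfy the axioms -/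

section NonnegIsotone

variable {X : Type u} [TopologicalSpace X] [Preorder X]

theorem ofReal_mem_nonnegIsotone {g : C(X, ℝ)} (h0 : ∀ x, 0 ≤ g x) (hm : Monotone g) :
    (⟨fun x => (g x : ℂ), by fun_prop⟩ : C(X, ℂ)) ∈ nonnegIsotone X :=
  ⟨g, h0, hm, fun _ => rfl⟩

open ComplexOrder in
theorem IsCompactOrderedSpace.le_iff_forall_nonnegIsotone (hX : IsCompactOrderedSpace X) {x y : X} :
    x ≤ y ↔ ∀ f ∈ nonnegIsotone X, f x ≤ f y := by
  constructor
  · rintro hxy f ⟨g, -, hm, hf⟩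
    rw [hf, hf]
    exact Complex.real_le_real.2 (hm hxy)
  · intro H
    by_contra hxy
    obtain ⟨g, h0, hm, hlt⟩ := hX.exists_monotone hxy
    exact (Complex.real_le_real.1 (H _ (ofReal_mem_nonnegIsotone h0 hm))).not_gt hlt

open ComplexOrder in
theorem IsCompactOrderedSpace.eq_of_forall_apply_eq (hX : IsCompactOrderedSpace X) {x y : X}
    (H : ∀ f : C(X, ℂ), f x = f y) : x = y :=
  hX.antisymm x y (hX.le_iff_forall_nonnegIsotone.2 fun f _ => (H f).le)
    (hX.le_iff_forall_nonnegIsotone.2 fun f _ => (H f).ge)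

/-- Differences of non-negative continuous isotone functions. -/
def isotoneDifferences (X : Type u) [TopologicalSpace X] [Preorder X] : Subalgebra ℝ C(X, ℝ) where
  carrier := {h | ∃ f g : C(X, ℝ), ((∀ x, 0 ≤ f x) ∧ Monotone f) ∧ ((∀ x, 0 ≤ g x) ∧ Monotone g) ∧
    h = f - g}
  mul_mem' := by
    rintro _ _ ⟨f, g, ⟨hf, hf'⟩, ⟨hg, hg'⟩, rfl⟩ ⟨k, l, ⟨hk, hk'⟩, ⟨hl, hl'⟩, rfl⟩
    -- Non-negativity is what keeps these products isotone.
    refine ⟨f * k + g * l, f * l + g * k, ⟨fun x => ?_, ?_⟩, ⟨fun x => ?_, ?_⟩, by ring⟩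
    · exact add_nonneg (mul_nonneg (hf x) (hk x)) (mul_nonneg (hg x) (hl x))
    · exact (hf'.mul hk' hf hk).add (hg'.mul hl' hg hl)
    · exact add_nonneg (mul_nonneg (hf x) (hl x)) (mul_nonneg (hg x) (hk x))
    · exact (hf'.mul hl' hf hl).add (hg'.mul hk' hg hk)
  add_mem' := by
    rintro _ _ ⟨f, g, ⟨hf, hf'⟩, ⟨hg, hg'⟩, rfl⟩ ⟨k, l, ⟨hk, hk'⟩, ⟨hl, hl'⟩, rfl⟩
    exact ⟨f + k, g + l, ⟨fun x => add_nonneg (hf x) (hk x), hf'.add hk'⟩,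
      ⟨fun x => add_nonneg (hg x) (hl x), hg'.add hl'⟩, by ring⟩
  algebraMap_mem' r :=
    ⟨.const X (max r 0), .const X (max (-r) 0), ⟨fun _ => le_max_right _ _, monotone_const⟩,
      ⟨fun _ => le_max_right _ _, monotone_const⟩, by
        ext x
        rcases le_total r 0 with h | h <;> simp [h]⟩

/-- Stone–Weierstrass: by antisymmetry, distinct points fail to be comparable in at least one
direction, and an isotone function then separates them. -/
theorem IsCompactOrderedSpace.topologicalClosure_isotoneDifferences [CompactSpace X]
    (hX : IsCompactOrderedSpace X) : (isotoneDifferences X).topologicalClosure = ⊤ := by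
  refine ContinuousMap.subalgebra_topologicalClosure_eq_top_of_separatesPoints _ fun x y hne => ?_
  have key : ∀ x y : X, ¬ x ≤ y → ∃ g ∈ isotoneDifferences X, g x ≠ g y := fun x y hxy => by
    obtain ⟨g, h0, hm, hlt⟩ := hX.exists_monotone hxy
    exact ⟨g, ⟨g, 0, ⟨h0, hm⟩, ⟨fun _ => le_rfl, monotone_const⟩, by simp⟩, hlt.ne'⟩
  by_cases hxy : x ≤ y
  · obtain ⟨g, hg, hg'⟩ := key y x fun hyx => hne (hX.antisymm x y hxy hyx)
    exact ⟨g, ⟨g, hg, rfl⟩, hg'.symm⟩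
  · obtain ⟨g, hg, hg'⟩ := key x y hxy
    exact ⟨g, ⟨g, hg, rfl⟩, hg'⟩

theorem isClosed_nonnegIsotone [CompactSpace X] : IsClosed (nonnegIsotone X) := by
  have : nonnegIsotone X = {f : C(X, ℂ) | (∀ x, 0 ≤ (f x).re) ∧ (∀ x, (f x).im = 0) ∧
      ∀ x y, x ≤ y → (f x).re ≤ (f y).re} := by
    ext f
    constructor
    · rintro ⟨g, h0, hm, hf⟩
      refine ⟨fun x => ?_, fun x => ?_, fun x y hxy => ?_⟩
      · rw [hf]; exact h0 x
      · rw [hf]; rfl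
      · rw [hf, hf]; exact hm hxy
    · rintro ⟨h0, him, hm⟩
      exact ⟨⟨fun x => (f x).re, by fun_prop⟩, h0, fun x y => hm x y,
        fun x => Complex.ext rfl (him x)⟩
  have hre (x : X) : Continuous fun f : C(X, ℂ) => (f x).re :=
    Complex.continuous_re.comp (continuous_eval_const x)
  have him (x : X) : Continuous fun f : C(X, ℂ) => (f x).im :=
    Complex.continuous_im.comp (continuous_eval_const x)
  rw [this]
  simp only [ofPred_and, ofPred_forall]
  refine (isClosed_iInter fun x => isClosed_le continuous_const (hre x)).inter
    ((isClosed_iInter fun x => isClosed_eq (him x) continuous_const).inter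
      (isClosed_iInter fun x => isClosed_iInter fun y => isClosed_iInter fun _ =>
        isClosed_le (hre x) (hre y)))

theorem ContinuousMap.inverse_apply {Y : Type*} [TopologicalSpace Y] {f : C(Y, ℂ)} (hf : IsUnit f)
    (y : Y) : Ring.inverse f y = (f y)⁻¹ :=
  eq_inv_of_mul_eq_one_left (by
    rw [← ContinuousMap.mul_apply, Ring.inverse_mul_cancel f hf, ContinuousMap.one_apply])

open ComplexOrder in
theorem IsCompactOrderedSpace.isIsotoneCone_nonnegIsotone [CompactSpace X]
    (hX : IsCompactOrderedSpace X) : IsIsotoneCone (nonnegIsotone X) where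
  add_mem := by
    rintro f ⟨g, h0, hm, hf⟩ f' ⟨g', h0', hm', hf'⟩
    exact ⟨g + g', fun x => add_nonneg (h0 x) (h0' x), hm.add hm', fun x => by simp [hf, hf']⟩
  smul_mem := by
    rintro a ha f ⟨g, h0, hm, hf⟩
    exact ⟨a • g, fun x => mul_nonneg ha.le (h0 x), fun x y hxy =>
      mul_le_mul_of_nonneg_left (hm hxy) ha.le, fun x => by simp [hf]⟩
  isClosed := isClosed_nonnegIsotone
  closure_sub := by
    apply subset_antisymm
    · refine closure_minimal ?_ (isClosed_eq continuous_star continuous_id)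
      rintro _ ⟨f, ⟨g, -, -, hf⟩, f', ⟨g', -, -, hf'⟩, rfl⟩
      show star (f - f') = f - f'
      ext x
      simp [hf, hf']
    · intro f hf
      let ι : C(X, ℝ) → C(X, ℂ) := fun g => (⟨Complex.ofReal, by fun_prop⟩ : C(ℝ, ℂ)).comp g
      have hι : Continuous ι := ContinuousMap.continuous_postcomp _
      let k : C(X, ℝ) := ⟨fun x => (f x).re, by fun_prop⟩
      have hk : ι k = f := by
        ext x
        have : star (f x) = f x := congr($(show star f = f from hf) x)
        exact Complex.conj_eq_iff_re.1 this
      have hkmem : k ∈ closure (isotoneDifferences X : Set C(X, ℝ)) := by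
        rw [← Subalgebra.topologicalClosure_coe, hX.topologicalClosure_isotoneDifferences]
        trivial
      rw [← hk]
      refine map_mem_closure hι hkmem ?_
      rintro _ ⟨g, g', ⟨h0, hm⟩, ⟨h0', hm'⟩, rfl⟩
      exact ⟨ι g, ⟨g, h0, hm, fun _ => rfl⟩, ι g', ⟨g', h0', hm', fun _ => rfl⟩, by
        ext x; simp [ι]⟩
  stable := by
    refine Or.inl ?_
    rintro f ⟨g, h0, hm, hf⟩
    refine ⟨⟨?_, ?_⟩, ?_⟩
    · show star f = f
      ext x
      simp [hf]
    · rw [ContinuousMap.spectrum_eq_range]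
      rintro _ ⟨x, rfl⟩
      rw [hf]
      exact Complex.zero_le_real.2 (h0 x)
    · have hu : IsUnit (1 + f ^ 2) := by
        rw [ContinuousMap.isUnit_iff_forall_ne_zero]
        intro x
        have : (1 + f ^ 2 : C(X, ℂ)) x = ((1 + g x ^ 2 : ℝ) : ℂ) := by simp [hf]
        rw [this, Complex.ofReal_ne_zero]
        positivity
      refine ⟨⟨fun x => 2 * g x ^ 2 / (1 + g x ^ 2),
        Continuous.div (by fun_prop) (by fun_prop) fun x => by positivity⟩, fun x => ?_,
        fun x y hxy => ?_, fun x => ?_⟩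
      · exact isThreshold_sq_div.nonneg (h0 x)
      · exact isThreshold_sq_div.monotoneOn (h0 x) (h0 y) (hm hxy)
      · simp only [ContinuousMap.mul_apply, ContinuousMap.inverse_apply hu, ContinuousMap.pow_apply,
          ContinuousMap.add_apply, ContinuousMap.one_apply, hf, ContinuousMap.coe_mk]
        push_cast
        rw [div_eq_mul_inv]
        rfl

end NonnegIsotone

/-! ### The Gelfand transform and recovery of the cone -/

namespace OrderedSpectrum

variable {B : Type u} [CommCStarAlgebra B] (C : Set B)

instance : T2Space (OrderedSpectrum C) :=
  inferInstanceAs (T2Space (WeakDual.characterSpace ℂ B))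

instance : AlgHomClass (OrderedSpectrum C) ℂ B ℂ :=
  inferInstanceAs (AlgHomClass (WeakDual.characterSpace ℂ B) ℂ B ℂ)

instance : StarHomClass (OrderedSpectrum C) B ℂ :=
  inferInstanceAs (StarHomClass (WeakDual.characterSpace ℂ B) B ℂ)

instance : ContinuousMapClass (OrderedSpectrum C) B ℂ :=
  inferInstanceAs (ContinuousMapClass (WeakDual.characterSpace ℂ B) B ℂ)

/-- The Gelfand transform. -/
noncomputable def gelfandEquiv : B ≃⋆ₐ[ℂ] C(OrderedSpectrum C, ℂ) :=
  gelfandStarTransform B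

variable {C}

theorem gelfandEquiv_apply (f : B) (x : OrderedSpectrum C) : gelfandEquiv C f x = x f := rfl

theorem apply_gelfandEquiv_symm (f : C(OrderedSpectrum C, ℂ)) (x : OrderedSpectrum C) :
    x ((gelfandEquiv C).symm f) = f x := by
  rw [← gelfandEquiv_apply, StarAlgEquiv.apply_symm_apply]

theorem isometry_gelfandEquiv : Isometry (gelfandEquiv C) := gelfandTransform_isometry B

theorem continuous_eval (f : B) : Continuous fun x : OrderedSpectrum C => x f :=
  map_continuous (gelfandEquiv C f)

theorem eq_of_forall_apply_eq {f g : B} (H : ∀ x : OrderedSpectrum C, x f = x g) : f = g :=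
  (gelfandEquiv C).injective (ContinuousMap.ext H)

theorem apply_inverse {f : B} (hf : IsUnit f) (x : OrderedSpectrum C) :
    x (Ring.inverse f) = (x f)⁻¹ :=
  eq_inv_of_mul_eq_one_left (by rw [← map_mul, Ring.inverse_mul_cancel f hf, map_one])

end OrderedSpectrum

namespace IsIsotoneCone

variable {B : Type u} [CommCStarAlgebra B] {C : Set B}

/-- Since f = (f + f) - f is a difference of cone elements, (iii) applies. The second alternative of
(iv) does not assume this. -/
theorem isSelfAdjoint (hC : IsIsotoneCone C) {f : B} (hf : f ∈ C) : IsSelfAdjoint f := by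
  have : f ∈ {h : B | IsSelfAdjoint h} := by
    rw [← hC.closure_sub]
    exact subset_closure ⟨f + f, hC.add_mem f hf f hf, f, hf, by simp⟩
  exact this

theorem apply_eq_re (hC : IsIsotoneCone C) {f : B} (hf : f ∈ C) (x : OrderedSpectrum C) :
    x f = ((x f).re : ℂ) := by
  refine (Complex.conj_eq_iff_re.1 ?_).symm
  show star (x f) = x f
  rw [← map_star, hC.isSelfAdjoint hf]

open ComplexOrder in
theorem apply_nonneg (hC : IsIsotoneCone C) {f : B} (hf : f ∈ C) (x : OrderedSpectrum C) :
    0 ≤ (x f).re := by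
  rcases hC.stable with H | H
  · exact (Complex.nonneg_iff.1 ((H f hf).1.2 _ (AlgHom.apply_mem_spectrum x f))).1
  · by_contra! hneg
    -- Rescaling makes the value at `x` equal to -1, so `x` annihilates an element required to be
    -- invertible.
    have ha : 0 < -(x f).re⁻¹ := neg_pos.2 (inv_lt_zero.2 hneg)
    have hu := (H _ (hC.smul_mem _ ha f hf)).1.map x
    refine hu.ne_zero ?_
    rw [map_add, map_one, map_smul, hC.apply_eq_re hf x, smul_eq_mul, ← Complex.ofReal_mul,
      neg_mul, Complex.ofReal_re, inv_mul_cancel₀ hneg.ne]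
    simp

open ComplexOrder in
-- This merges the two alternatives of (iv); from here on only the threshold property is used.
theorem exists_threshold (hC : IsIsotoneCone C) : ∃ h : ℝ → ℝ, IsThreshold h ∧
    ∀ f ∈ C, ∃ g ∈ C, ∀ x : OrderedSpectrum C, x g = (h (x f).re : ℂ) := by
  rcases hC.stable with H | H
  · refine ⟨_, isThreshold_sq_div, fun f hf => ⟨_, (H f hf).2, fun x => ?_⟩⟩
    have hu : IsUnit (1 + f ^ 2) := by
      rw [← MulEquiv.isUnit_map (OrderedSpectrum.gelfandEquiv C),
        ContinuousMap.isUnit_iff_forall_ne_zero]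
      intro y
      rw [OrderedSpectrum.gelfandEquiv_apply, map_add, map_one, map_pow, hC.apply_eq_re hf y,
        ← Complex.ofReal_pow, ← Complex.ofReal_one, ← Complex.ofReal_add, Complex.ofReal_ne_zero]
      positivity
    rw [map_mul, map_mul, OrderedSpectrum.apply_inverse hu, map_add, map_one, map_pow, map_ofNat,
      hC.apply_eq_re hf x]
    push_cast
    rw [div_eq_mul_inv]
    rfl
  · refine ⟨_, isThreshold_div_sq, fun f hf => ⟨_, (H f hf).2, fun x => ?_⟩⟩
    rw [map_pow, map_mul, map_mul, OrderedSpectrum.apply_inverse (H f hf).1, map_add, map_one,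
      map_ofNat, hC.apply_eq_re hf x]
    push_cast
    rw [div_eq_mul_inv]
    rfl

/-- Characters which agree on `C` agree everywhere. -/
theorem eq_of_eqOn (hC : IsIsotoneCone C) {x y : OrderedSpectrum C} (H : ∀ f ∈ C, x f = y f)
    (f : B) : x f = y f := by
  have key : ∀ f : B, IsSelfAdjoint f → x f = y f := by
    have hsub : {h : B | IsSelfAdjoint h} ⊆ {h | x h = y h} := by
      rw [← hC.closure_sub]
      refine closure_minimal ?_ (isClosed_eq (map_continuous x) (map_continuous y))
      rintro _ ⟨g, hg, k, hk, rfl⟩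
      show x (g - k) = y (g - k)
      rw [map_sub, map_sub, H g hg, H k hk]
    exact fun f hf => hsub hf
  rw [← realPart_add_I_smul_imaginaryPart f]
  simp only [map_add, map_smul, key _ (realPart f).2, key _ (imaginaryPart f).2]

theorem nonempty (hC : IsIsotoneCone C) : C.Nonempty := by
  have h0 : (0 : B) ∈ {h : B | IsSelfAdjoint h} := IsSelfAdjoint.zero B
  rw [← hC.closure_sub] at h0
  obtain ⟨_, f, hf, -⟩ := closure_nonempty_iff.1 ⟨0, h0⟩
  exact ⟨f, hf⟩

theorem zero_mem (hC : IsIsotoneCone C) : (0 : B) ∈ C := by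
  obtain ⟨f, hf⟩ := hC.nonempty
  have ht : Tendsto (fun a : ℝ => (a : ℂ) • f) (𝓝[>] 0) (𝓝 0) := by
    have : Continuous fun a : ℝ => (a : ℂ) • f := by fun_prop
    simpa using (this.tendsto 0).mono_left nhdsWithin_le_nhds
  exact hC.isClosed.mem_of_tendsto ht
    (eventually_mem_nhdsWithin.mono fun a ha => hC.smul_mem a ha f hf)

/-- Otherwise `x` vanishes on the cone, hence by density on all hermitian elements, including 1. -/
theorem exists_apply_pos (hC : IsIsotoneCone C) (x : OrderedSpectrum C) :
    ∃ f ∈ C, 0 < (x f).re := by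
  by_contra! H
  have hsub : {h : B | IsSelfAdjoint h} ⊆ {h | x h = 0} := by
    rw [← hC.closure_sub]
    refine closure_minimal ?_ (isClosed_eq (map_continuous x) continuous_const)
    have hz : ∀ f ∈ C, x f = 0 := fun f hf => by
      rw [hC.apply_eq_re hf, le_antisymm (H f hf) (hC.apply_nonneg hf x), Complex.ofReal_zero]
    rintro _ ⟨g, hg, k, hk, rfl⟩
    show x (g - k) = 0
    rw [map_sub, hz g hg, hz k hk, sub_zero]
  have h1 : x 1 = 0 := hsub (IsSelfAdjoint.one B)
  rw [map_one] at h1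
  exact one_ne_zero h1

theorem le_iff (hC : IsIsotoneCone C) {x y : OrderedSpectrum C} :
    x ≤ y ↔ ∀ f ∈ C, (x f).re ≤ (y f).re := by
  refine forall₂_congr fun f hf => ?_
  rw [hC.apply_eq_re hf x, hC.apply_eq_re hf y]
  exact Complex.real_le_real

theorem isCompactOrderedSpace (hC : IsIsotoneCone C) :
    IsCompactOrderedSpace (OrderedSpectrum C) where
  compact := inferInstance
  closed := by
    simp only [hC.le_iff, ofPred_forall]
    exact isClosed_iInter fun f => isClosed_iInter fun _ => isClosed_le
      (Complex.continuous_re.comp ((OrderedSpectrum.continuous_eval f).comp continuous_fst))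
      (Complex.continuous_re.comp ((OrderedSpectrum.continuous_eval f).comp continuous_snd))
  antisymm x y hxy hyx := DFunLike.ext _ _ <| hC.eq_of_eqOn fun f hf => by
    rw [hC.apply_eq_re hf x, hC.apply_eq_re hf y,
      le_antisymm (hC.le_iff.1 hxy f hf) (hC.le_iff.1 hyx f hf)]

/-- A cone satisfying the axioms is carried by the Gelfand map onto the cone of all non-negative
continuous isotone functions. -/
theorem image_gelfandEquiv (hC : IsIsotoneCone C) :
    OrderedSpectrum.gelfandEquiv C '' C = nonnegIsotone (OrderedSpectrum C) := by
  apply subset_antisymm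
  · rintro _ ⟨f, hf, rfl⟩
    refine ⟨⟨fun x => (x f).re, Complex.continuous_re.comp (OrderedSpectrum.continuous_eval f)⟩,
      hC.apply_nonneg hf, fun x y hxy => hC.le_iff.1 hxy f hf, hC.apply_eq_re hf⟩
  · rintro F ⟨g, h0, hm, hF⟩
    obtain ⟨h, hh, hstab⟩ := hC.exists_threshold
    let ι : C(OrderedSpectrum C, ℝ) → C(OrderedSpectrum C, ℂ) := fun k =>
      (⟨Complex.ofReal, by fun_prop⟩ : C(ℝ, ℂ)).comp k
    have hι : Continuous ι := ContinuousMap.continuous_postcomp _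
    let r : B → C(OrderedSpectrum C, ℝ) := fun f =>
      ⟨fun x => (x f).re, Complex.continuous_re.comp (OrderedSpectrum.continuous_eval f)⟩
    -- The cone transported to real functions, where the approximation theorem applies.
    let S : Set C(OrderedSpectrum C, ℝ) := {k | (OrderedSpectrum.gelfandEquiv C).symm (ι k) ∈ C}
    have hr : ∀ f ∈ C, r f ∈ S := fun f hf => by
      have : ι (r f) = OrderedSpectrum.gelfandEquiv C f :=
        ContinuousMap.ext fun x => (hC.apply_eq_re hf x).symm
      show (OrderedSpectrum.gelfandEquiv C).symm (ι (r f)) ∈ C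
      rwa [this, StarAlgEquiv.symm_apply_apply]
    have happly : ∀ (k : C(OrderedSpectrum C, ℝ)) (x : OrderedSpectrum C),
        x ((OrderedSpectrum.gelfandEquiv C).symm (ι k)) = (k x : ℂ) := fun k x =>
      OrderedSpectrum.apply_gelfandEquiv_symm _ _
    have hS : IsStableCone h S :=
      { zero_mem := by
          have : ι 0 = 0 := by ext; simp [ι]
          show (OrderedSpectrum.gelfandEquiv C).symm (ι 0) ∈ C
          rw [this, map_zero]
          exact hC.zero_mem
        add_mem := fun f hf g hg => by
          have : ι (f + g) = ι f + ι g := by ext; simp [ι]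
          show (OrderedSpectrum.gelfandEquiv C).symm (ι (f + g)) ∈ C
          rw [this, map_add]
          exact hC.add_mem _ hf _ hg
        smul_mem := fun a ha f hf => by
          have : ι (a • f) = (a : ℂ) • ι f := by ext; simp [ι]
          show (OrderedSpectrum.gelfandEquiv C).symm (ι (a • f)) ∈ C
          rw [this, map_smul]
          exact hC.smul_mem a ha _ hf
        isClosed := hC.isClosed.preimage
          ((OrderedSpectrum.isometry_gelfandEquiv.right_inv
            (OrderedSpectrum.gelfandEquiv C).apply_symm_apply).continuous.comp hι)
        nonneg := fun k hk x => by
          have := hC.apply_nonneg hk x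
          rwa [happly, Complex.ofReal_re] at this
        exists_pos := fun x => by
          obtain ⟨f, hf, hpos⟩ := hC.exists_apply_pos x
          exact ⟨r f, hr f hf, hpos⟩
        stable := fun k hk => by
          obtain ⟨f, hf, hfx⟩ := hstab _ hk
          refine ⟨r f, hr f hf, fun x => ?_⟩
          show (x f).re = _
          rw [hfx, happly, Complex.ofReal_re, Complex.ofReal_re] }
    have hg : g ∈ S := hS.mem_of_isotone hh h0 fun x y hxy =>
      hm (hC.le_iff.2 fun f hf => hxy _ (hr f hf))
    exact ⟨_, hg, by
      rw [StarAlgEquiv.apply_symm_apply]; exact ContinuousMap.ext fun x => (hF x).symm⟩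

theorem mem_iff (hC : IsIsotoneCone C) {f : B} :
    f ∈ C ↔ OrderedSpectrum.gelfandEquiv C f ∈ nonnegIsotone (OrderedSpectrum C) := by
  rw [← hC.image_gelfandEquiv]
  exact (Function.Injective.mem_set_image (OrderedSpectrum.gelfandEquiv C).injective).symm

end IsIsotoneCone

/-! ### Functoriality and the duality -/

namespace OrderedSpectrum

variable {B B' : Type u} [CommCStarAlgebra B] [CommCStarAlgebra B'] {C : Set B} {C' : Set B'}

/-- The continuous map of spectra induced by a *-homomorphism. -/
noncomputable def pullback (C : Set B) (C' : Set B') (φ : B →⋆ₐ[ℂ] B') :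
    C(OrderedSpectrum C', OrderedSpectrum C) :=
  WeakDual.CharacterSpace.compContinuousMap φ

theorem pullback_apply (φ : B →⋆ₐ[ℂ] B') (x : OrderedSpectrum C') (f : B) :
    pullback C C' φ x f = x (φ f) := rfl

theorem monotone_pullback {φ : B →⋆ₐ[ℂ] B'} (hφ : MapsTo φ C C') : Monotone (pullback C C' φ) :=
  fun _ _ hxy f hf => hxy (φ f) (hφ hf)

end OrderedSpectrum

section Duality

open OrderedSpectrum

variable {B B' : Type u} [CommCStarAlgebra B] [CommCStarAlgebra B'] {C : Set B} {C' : Set B'}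
variable {X Y : Type u} [TopologicalSpace X] [Preorder X] [TopologicalSpace Y] [Preorder Y]

/-- Evaluation at points, as a homeomorphism onto the spectrum. -/
noncomputable def IsCompactOrderedSpace.evalHomeo [CompactSpace X] (hX : IsCompactOrderedSpace X) :
    X ≃ₜ OrderedSpectrum (nonnegIsotone X) :=
  haveI := hX.t2Space
  WeakDual.CharacterSpace.homeoEval X ℂ

theorem IsCompactOrderedSpace.evalHomeo_apply [CompactSpace X] (hX : IsCompactOrderedSpace X)
    (x : X) (f : C(X, ℂ)) : hX.evalHomeo x f = f x := rfl

theorem IsCompactOrderedSpace.apply_evalHomeo_symm [CompactSpace X] (hX : IsCompactOrderedSpace X)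
    (x : OrderedSpectrum (nonnegIsotone X)) (f : C(X, ℂ)) : f (hX.evalHomeo.symm x) = x f := by
  rw [← hX.evalHomeo_apply, Homeomorph.apply_symm_apply]

theorem IsCompactOrderedSpace.evalHomeo_le_iff [CompactSpace X] (hX : IsCompactOrderedSpace X)
    {x y : X} : hX.evalHomeo x ≤ hX.evalHomeo y ↔ x ≤ y :=
  hX.le_iff_forall_nonnegIsotone.symm

theorem SpaceIso.symm (h : SpaceIso X Y) : SpaceIso Y X := by
  obtain ⟨e, he⟩ := h
  exact ⟨e.symm, fun x y => by rw [← he, e.apply_symm_apply, e.apply_symm_apply]⟩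

theorem SpaceIso.trans {Z : Type u} [TopologicalSpace Z] [Preorder Z] (h : SpaceIso X Y)
    (h' : SpaceIso Y Z) : SpaceIso X Z := by
  obtain ⟨e, he⟩ := h
  obtain ⟨e', he'⟩ := h'
  exact ⟨e.trans e', fun x y => (he' _ _).trans (he _ _)⟩

theorem PairIso.symm (h : PairIso C C') : PairIso C' C := by
  obtain ⟨e, rfl⟩ := h
  refine ⟨e.symm, ?_⟩
  rw [image_image]
  simp

theorem PairIso.trans {B'' : Type u} [CommCStarAlgebra B''] {C'' : Set B''} (h : PairIso C C')
    (h' : PairIso C' C'') : PairIso C C'' := by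
  obtain ⟨e, rfl⟩ := h
  obtain ⟨e', rfl⟩ := h'
  exact ⟨e.trans e', by rw [image_image]; rfl⟩

theorem PairIso.spaceIso (h : PairIso C C') :
    SpaceIso (OrderedSpectrum C) (OrderedSpectrum C') := by
  obtain ⟨e, rfl⟩ := h
  refine ⟨⟨⟨pullback _ _ (e.symm : B' →⋆ₐ[ℂ] B), pullback _ _ (e : B →⋆ₐ[ℂ] B'), fun x => ?_,
    fun x => ?_⟩, map_continuous _, map_continuous _⟩, fun x y => ?_⟩
  · refine DFunLike.ext _ _ fun f => ?_
    rw [pullback_apply, pullback_apply]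
    exact congrArg x (e.symm_apply_apply f)
  · refine DFunLike.ext _ _ fun f => ?_
    rw [pullback_apply, pullback_apply]
    exact congrArg x (e.apply_symm_apply f)
  · refine forall_mem_image.trans (forall₂_congr fun f hf => ?_)
    have (z : OrderedSpectrum C) :
        pullback (e '' C) C (e.symm : B' →⋆ₐ[ℂ] B) z (e f) = z f :=
      congrArg z (e.symm_apply_apply f)
    exact iff_of_eq (congrArg₂ _ (this x) (this y))

theorem mapsTo_nonnegIsotone_comp {g : C(X, Y)} (hg : Monotone g) :
    MapsTo (fun f : C(Y, ℂ) => f.comp g) (nonnegIsotone Y) (nonnegIsotone X) := by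
  rintro f ⟨k, h0, hm, hf⟩
  exact ⟨k.comp g, fun x => h0 _, hm.comp hg, fun x => hf _⟩

theorem SpaceIso.pairIso [CompactSpace X] [CompactSpace Y] (h : SpaceIso X Y) :
    PairIso (nonnegIsotone X) (nonnegIsotone Y) := by
  obtain ⟨e, he⟩ := h
  have hmono : Monotone e := fun x y hxy => (he x y).2 hxy
  have hmono' : Monotone e.symm := fun x y hxy => by
    rwa [← he, e.apply_symm_apply, e.apply_symm_apply]
  refine ⟨e.symm.compStarAlgEquiv' ℂ ℂ, subset_antisymm ?_ fun f hf => ?_⟩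
  · exact (mapsTo_nonnegIsotone_comp (g := (e.symm : C(Y, X))) hmono').image_subset
  · refine ⟨f.comp (e : C(X, Y)), mapsTo_nonnegIsotone_comp (g := (e : C(X, Y))) hmono hf, ?_⟩
    exact ContinuousMap.ext fun y => congrArg f (e.apply_symm_apply y)

theorem IsIsotoneCone.pairIso_nonnegIsotone (hC : IsIsotoneCone C) :
    PairIso C (nonnegIsotone (OrderedSpectrum C)) :=
  ⟨gelfandEquiv C, hC.image_gelfandEquiv⟩

theorem IsCompactOrderedSpace.spaceIso_orderedSpectrum [CompactSpace X]
    (hX : IsCompactOrderedSpace X) : SpaceIso X (OrderedSpectrum (nonnegIsotone X)) :=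
  ⟨hX.evalHomeo, fun _ _ => hX.evalHomeo_le_iff⟩

/-- The *-homomorphism inducing a given continuous map of spectra. -/
noncomputable def OrderedSpectrum.lift (g : C(OrderedSpectrum C', OrderedSpectrum C)) :
    B →⋆ₐ[ℂ] B' :=
  ((gelfandEquiv C').symm : C(OrderedSpectrum C', ℂ) →⋆ₐ[ℂ] B').comp
    ((g.compStarAlgHom' ℂ ℂ).comp (gelfandEquiv C : B →⋆ₐ[ℂ] C(OrderedSpectrum C, ℂ)))

theorem OrderedSpectrum.apply_lift (g : C(OrderedSpectrum C', OrderedSpectrum C))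
    (x : OrderedSpectrum C') (f : B) : x (lift g f) = g x f :=
  apply_gelfandEquiv_symm ((gelfandEquiv C f).comp g) x

/-- Membership in `C'` can be tested on the spectrum, where composing with an isotone map preserves
isotony. -/
theorem IsIsotoneCone.mapsTo_lift (hC : IsIsotoneCone C) (hC' : IsIsotoneCone C')
    {g : C(OrderedSpectrum C', OrderedSpectrum C)} (hg : Monotone g) :
    MapsTo (lift g) C C' := fun f hf => by
  rw [hC'.mem_iff]
  have : gelfandEquiv C' (lift g f) = (gelfandEquiv C f).comp g :=
    ContinuousMap.ext fun x => apply_lift g x f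
  rw [this]
  exact mapsTo_nonnegIsotone_comp hg (hC.mem_iff.1 hf)

end Duality

theorem mainTheorem4 :
    -- Map I is well defined
    (∀ (B : Type u) [CommCStarAlgebra B] (C : Set B), IsIsotoneCone C →
      IsCompactOrderedSpace (OrderedSpectrum C)) ∧
    -- Map II is well defined
    (∀ (X : Type u) [TopologicalSpace X] [Preorder X] [CompactSpace X],
      IsCompactOrderedSpace X → IsIsotoneCone (nonnegIsotone X)) ∧
    -- Map I followed by Map II: the Gelfand map is an isomorphism of pairs
    (∀ (B : Type u) [CommCStarAlgebra B] (C : Set B), IsIsotoneCone C →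
      ∃ e : B ≃⋆ₐ[ℂ] C(OrderedSpectrum C, ℂ),
        (∀ (f : B) (x : OrderedSpectrum C), e f x = x f) ∧ Isometry e ∧
          e '' C = nonnegIsotone (OrderedSpectrum C)) ∧
    -- Map II followed by Map I: evaluation is an isomorphism of ordered spaces
    (∀ (X : Type u) [TopologicalSpace X] [Preorder X] [CompactSpace X],
      IsCompactOrderedSpace X →
      ∃ e : X ≃ₜ OrderedSpectrum (nonnegIsotone X),
        (∀ (x : X) (f : C(X, ℂ)), e x f = f x) ∧ ∀ x y, e x ≤ e y ↔ x ≤ y) ∧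
    -- both maps preserve and reflect isomorphism
    (∀ (B B' : Type u) [CommCStarAlgebra B] [CommCStarAlgebra B'] (C : Set B) (C' : Set B'),
      IsIsotoneCone C → IsIsotoneCone C' →
      (PairIso C C' ↔ SpaceIso (OrderedSpectrum C) (OrderedSpectrum C'))) ∧
    (∀ (X Y : Type u) [TopologicalSpace X] [Preorder X] [CompactSpace X]
      [TopologicalSpace Y] [Preorder Y] [CompactSpace Y],
      IsCompactOrderedSpace X → IsCompactOrderedSpace Y →
      (SpaceIso X Y ↔ PairIso (nonnegIsotone X) (nonnegIsotone Y))) ∧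
    -- duality on morphisms, for Map I
    (∀ (B B' : Type u) [CommCStarAlgebra B] [CommCStarAlgebra B'] (C : Set B) (C' : Set B'),
      IsIsotoneCone C → IsIsotoneCone C' →
      (∀ φ : B →⋆ₐ[ℂ] B', Set.MapsTo φ C C' →
        ∃! g : OrderedSpectrum C' →Co OrderedSpectrum C, ∀ x f, g x f = x (φ f)) ∧
      (∀ g : OrderedSpectrum C' →Co OrderedSpectrum C,
        ∃! φ : B →⋆ₐ[ℂ] B', Set.MapsTo φ C C' ∧ ∀ x f, g x f = x (φ f))) ∧
    -- duality on morphisms, for Map II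
    (∀ (X Y : Type u) [TopologicalSpace X] [Preorder X] [CompactSpace X]
      [TopologicalSpace Y] [Preorder Y] [CompactSpace Y],
      IsCompactOrderedSpace X → IsCompactOrderedSpace Y →
      (∀ g : X →Co Y,
        ∃! φ : C(Y, ℂ) →⋆ₐ[ℂ] C(X, ℂ),
          Set.MapsTo φ (nonnegIsotone Y) (nonnegIsotone X) ∧ ∀ f x, φ f x = f (g x)) ∧
      (∀ φ : C(Y, ℂ) →⋆ₐ[ℂ] C(X, ℂ), Set.MapsTo φ (nonnegIsotone Y) (nonnegIsotone X) →
        ∃! g : X →Co Y, ∀ f x, φ f x = f (g x))) := by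
  refine ⟨fun B _ C hC => hC.isCompactOrderedSpace,
    fun X _ _ _ hX => hX.isIsotoneCone_nonnegIsotone,
    fun B _ C hC => ⟨OrderedSpectrum.gelfandEquiv C, OrderedSpectrum.gelfandEquiv_apply,
      OrderedSpectrum.isometry_gelfandEquiv, hC.image_gelfandEquiv⟩,
    fun X _ _ _ hX => ⟨hX.evalHomeo, hX.evalHomeo_apply, fun _ _ => hX.evalHomeo_le_iff⟩,
    -- Isomorphisms are reflected by passing to the double dual and composing with the canonical
    -- isomorphisms.
    fun B B' _ _ C C' hC hC' => ⟨PairIso.spaceIso, fun h =>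
      (hC.pairIso_nonnegIsotone.trans h.pairIso).trans hC'.pairIso_nonnegIsotone.symm⟩,
    fun X Y _ _ _ _ _ _ hX hY => ⟨SpaceIso.pairIso, fun h =>
      (hX.spaceIso_orderedSpectrum.trans h.spaceIso).trans hY.spaceIso_orderedSpectrum.symm⟩,
    fun B B' _ _ C C' hC hC' => ⟨fun φ hφ => ?_, fun g => ?_⟩,
    fun X Y _ _ _ _ _ _ hX hY => ⟨fun g => ?_, fun φ hφ => ?_⟩⟩
  · refine ⟨⟨⟨OrderedSpectrum.pullback C C' φ, OrderedSpectrum.monotone_pullback hφ⟩,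
      map_continuous (OrderedSpectrum.pullback C C' φ)⟩,
      OrderedSpectrum.pullback_apply φ, fun g hg => ?_⟩
    exact DFunLike.ext _ _ fun x => DFunLike.ext _ _ fun f => hg x f
  · let G : C(OrderedSpectrum C', OrderedSpectrum C) := ⟨g, map_continuous g⟩
    refine ⟨OrderedSpectrum.lift G,
      ⟨hC.mapsTo_lift hC' g.monotone', fun x f => (OrderedSpectrum.apply_lift G x f).symm⟩,
      fun φ hφ => ?_⟩
    refine DFunLike.ext _ _ fun f => OrderedSpectrum.eq_of_forall_apply_eq (C := C') fun x => ?_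
    rw [OrderedSpectrum.apply_lift]
    exact (hφ.2 x f).symm
  · refine ⟨ContinuousMap.compStarAlgHom' ℂ ℂ ⟨g, map_continuous g⟩,
      ⟨mapsTo_nonnegIsotone_comp (g := ⟨g, map_continuous g⟩) g.monotone', fun _ _ => rfl⟩,
      fun φ hφ => ?_⟩
    exact DFunLike.ext _ _ fun f => ContinuousMap.ext fun x => hφ.2 f x
  -- The point map is the map of spectra induced by `φ`, conjugated by the evaluation
  -- homeomorphisms.
  · let G := OrderedSpectrum.pullback (nonnegIsotone Y) (nonnegIsotone X) φ
    have happly (f : C(Y, ℂ)) (x : X) : φ f x = f (hY.evalHomeo.symm (G (hX.evalHomeo x))) := by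
      rw [hY.apply_evalHomeo_symm]
      rfl
    refine ⟨⟨⟨fun x => hY.evalHomeo.symm (G (hX.evalHomeo x)), fun x y hxy => ?_⟩,
      hY.evalHomeo.symm.continuous.comp ((map_continuous G).comp hX.evalHomeo.continuous)⟩,
      happly, fun g hg => ?_⟩
    · rw [← hY.evalHomeo_le_iff, Homeomorph.apply_symm_apply, Homeomorph.apply_symm_apply]
      exact OrderedSpectrum.monotone_pullback hφ (hX.evalHomeo_le_iff.2 hxy)
    · refine DFunLike.ext _ _ fun x => hY.eq_of_forall_apply_eq fun f => ?_
      rw [← hg]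
      exact happly f x
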